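/- Let $H$ be a complex Hilbert space with scalar product $(\cdot,\cdot)$ (conjugate-linear in the second argument), let $\{U(t)\}_{t\ge 0}$ be a strongly continuous semigroup ($C_0$-semigroup) of bounded linear operators on $H$ with generator $L$, and let $L^\dagger$ be the adjoint of $L$. Let $z\in D(L^\dagger)$ with $z\neq 0$, and put $P:=(\cdot,z)(z,z)^{-1}z$ and $Q:=1-P$. Products of operators carry their natural domains, $D(QL)=D(L)$, $D(L^\dagger Q)=\{x\in H: Qx\in D(L^\dagger)\}$, and $D(\overline{QL}\,Q)=\{x\in H: Qx\in D(\overline{QL})\}$. Then $QL$ is closable, and each of $\overline{QL}$ and $L^\dagger Q$ is the generator of a unique $C_0$-semigroup on $H$, denoted by $\{e^{\overline{QL}\,t}\}_{t\ge0}$ and $\{e^{L^\dagger Q\,t}\}_{t\ge0}$, respectively. The family $$G(t):=P+e^{\overline{QL}\,t}Q,\qquad t\ge 0,$$ is a $C_0$-semigroup whose generator is $\overline{QL}\,Q$. Moreover, $\{P+Qe^{L^\dagger Q\,t}\}_{t\ge 0}$ is a $C_0$-semigroup, and $G(t)=\bigl(P+Qe^{L^\dagger Q\,t}\bigr)^\dagger$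 for all $t\ge0$. -/

import Mathlib

open Filter Topology
open scoped NNReal

noncomputable section

namespace MoriZwanzig

variable {H : Type*} [NormedAddCommGroup H] [InnerProductSpace ℂ H]

/-- A strongly continuous semigroup (`C₀`-semigroup) of bounded linear operators on `H`. -/
structure IsC0Semigroup (T : ℝ≥0 → H →L[ℂ] H) : Prop where
  map_zero : T 0 = 1
  map_add : ∀ s t : ℝ≥0, T (s + t) = T s ∘L T t
  continuous_orbit : ∀ x : H, Continuous fun t : ℝ≥0 => T t x

/-- `y` is the right derivative at `0` of the orbit map `t ↦ T t x`, i.e.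
`y = lim_{h ↘ 0} h⁻¹ (T h x - x)`. -/
def HasOrbitDeriv (T : ℝ≥0 → H →L[ℂ] H) (x y : H) : Prop :=
  Tendsto (fun h : ℝ≥0 => ((h : ℝ) : ℂ)⁻¹ • (T h x - x)) (𝓝[>] 0) (𝓝 y)

theorem HasOrbitDeriv.unique {T : ℝ≥0 → H →L[ℂ] H} {x y y' : H}
    (h : HasOrbitDeriv T x y) (h' : HasOrbitDeriv T x y') : y = y' :=
  tendsto_nhds_unique h h'

theorem HasOrbitDeriv.zero (T : ℝ≥0 → H →L[ℂ] H) : HasOrbitDeriv T 0 0 := by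
  simp [HasOrbitDeriv]

theorem HasOrbitDeriv.add {T : ℝ≥0 → H →L[ℂ] H} {x y x' y' : H}
    (h : HasOrbitDeriv T x y) (h' : HasOrbitDeriv T x' y') :
    HasOrbitDeriv T (x + x') (y + y') := by
  refine (Tendsto.add h h').congr fun r => ?_
  rw [map_add, ← smul_add]
  congr 1
  abel

theorem HasOrbitDeriv.smul {T : ℝ≥0 → H →L[ℂ] H} {x y : H} (c : ℂ)
    (h : HasOrbitDeriv T x y) : HasOrbitDeriv T (c • x) (c • y) := by
  refine (Tendsto.const_smul h c).congr fun r => ?_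
  rw [map_smul, ← smul_sub, smul_comm]

/-- The (infinitesimal) generator of a family `T`: the operator `x ↦ lim_{h ↘ 0} h⁻¹ (T h x - x)`
on the domain of all `x` for which this limit exists. -/
def generator (T : ℝ≥0 → H →L[ℂ] H) : H →ₗ.[ℂ] H where
  domain :=
    { carrier := {x | ∃ y, HasOrbitDeriv T x y}
      zero_mem' := ⟨0, .zero T⟩
      add_mem' := fun ⟨y, hy⟩ ⟨y', hy'⟩ => ⟨y + y', hy.add hy'⟩
      smul_mem' := fun c _ ⟨y, hy⟩ => ⟨c • y, hy.smul c⟩ }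
  toFun :=
    { toFun := fun x => Classical.choose x.2
      map_add' := fun x x' => (Classical.choose_spec (x + x').2).unique
        ((Classical.choose_spec x.2).add (Classical.choose_spec x'.2))
      map_smul' := fun c x => (Classical.choose_spec (c • x).2).unique
        ((Classical.choose_spec x.2).smul c) }

theorem mem_generator_domain_iff {T : ℝ≥0 → H →L[ℂ] H} {x : H} :
    x ∈ (generator T).domain ↔ ∃ y, HasOrbitDeriv T x y := Iff.rfl

theorem hasOrbitDeriv_generator {T : ℝ≥0 → H →L[ℂ] H} (x : (generator T).domain) :
    HasOrbitDeriv T x (generator T x) :=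
  Classical.choose_spec x.2

/-- `T` is a strongly continuous semigroup whose generator is the (unbounded) operator `A`,
i.e. `T t = e^{A t}`. -/
structure IsC0SemigroupGeneratedBy (T : ℝ≥0 → H →L[ℂ] H) (A : H →ₗ.[ℂ] H) : Prop where
  isC0Semigroup : IsC0Semigroup T
  generator_eq : generator T = A

/-- The product `A B` of an unbounded operator `A` and a bounded operator `B`, with its natural
domain `{x | B x ∈ D(A)}`. -/
def mulBounded (A : H →ₗ.[ℂ] H) (B : H →L[ℂ] H) : H →ₗ.[ℂ] H where
  domain := A.domain.comap (B : H →ₗ[ℂ] H)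
  toFun := A.toFun ∘ₗ ((B : H →ₗ[ℂ] H).restrict fun _ hx => hx)

theorem mem_mulBounded_domain_iff {A : H →ₗ.[ℂ] H} {B : H →L[ℂ] H} {x : H} :
    x ∈ (mulBounded A B).domain ↔ B x ∈ A.domain := Iff.rfl

theorem mulBounded_apply {A : H →ₗ.[ℂ] H} {B : H →L[ℂ] H} (x : (mulBounded A B).domain) :
    mulBounded A B x = A ⟨B x, x.2⟩ := rfl

/-- The product `B A` of a bounded operator `B` and an unbounded operator `A`, with domain
`D(A)`. -/
def boundedMul (B : H →L[ℂ] H) (A : H →ₗ.[ℂ] H) : H →ₗ.[ℂ] H :=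
  (B : H →ₗ[ℂ] H).compPMap A

/-- The rank-one Mori projection `x ↦ (x, z) (z, z)⁻¹ z`. Mathlib's inner product is
conjugate-linear in its first argument, so `(x, z)` is `inner ℂ z x`. -/
def moriProjection (z : H) : H →L[ℂ] H :=
  (inner ℂ z z)⁻¹ • (innerSL ℂ z).smulRight z

theorem moriProjection_apply (z x : H) :
    moriProjection z x = (inner ℂ z x * (inner ℂ z z)⁻¹) • z := by
  simp [moriProjection, smul_smul, mul_comm]

end MoriZwanzig

end

/-!
Write `P` for the projection onto `ℂ z`, `Q = 1 - P`. Since `z ∈ D(L†)`, for `x ∈ D(L)`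
`P L x = (z, z)⁻¹ (L x, z) z = (z, z)⁻¹ (x, L† z) z`,
so `P L` is the restriction to `D(L)` of a bounded rank-one operator `B`, and `Q L = L - B` is a
bounded perturbation of `L`. By the bounded perturbation theorem
(`IsC0Semigroup.exists_perturbation`) `Q L` generates a `C₀`-semigroup `S`. Generators are closed
(`IsC0Semigroup.isClosed_generator`), so `Q L` is its own closure, and they determine the semigroup
(`IsC0Semigroup.eq_of_generator_eq`).

On a Hilbert space the adjoints `S(t)†` again form a `C₀`-semigroup
(`IsC0Semigroup.adjoint`), generated by the adjoint of the generator
(`IsC0Semigroup.generator_adjoint`), here `(Q L)† = L† Q† = L† Q` (`adjoint_boundedMul`). Hence the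
semigroup generated by `L† Q` is `S(t)†`.

Finally the range of `Q L` lies in `ker P`, so `P S(t) = P` (`IsC0Semigroup.comp_eq_of_generator`),
which makes `G(t) = P + S(t) Q` a semigroup. Because `G(h) x - x = S(h) Q x - Q x`, its generator is
`Q L Q` on the natural domain, and `G(t)† = P + Q S(t)†`.

The perturbed semigroup is obtained from the Volterra equation
`V(t) x = U(t) x + ∫₀ᵗ U(t - s) B V(s) x ds`: after shifting the generator so that `U` decays fast
enough, the convolution operator is a strict contraction of the Banach space of bounded continuous
functions `ℝ≥0 → H`, and the equation is solved by a Neumann series.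
-/

noncomputable section

namespace MoriZwanzig

variable {H : Type*} [NormedAddCommGroup H] [InnerProductSpace ℂ H]

/-! ### Orbit derivatives and strong continuity -/

/-- The mean of a jointly continuous integrand over `[0, h]` tends to its value at the origin:
substituting `s = h u` turns it into a parametric integral over `[0, 1]`, continuous in `h`. -/
theorem tendsto_inv_smul_integral {E : Type*} [NormedAddCommGroup E] [NormedSpace ℂ E]
    [CompleteSpace E]     {F : ℝ → ℝ → E} (hF : Continuous (Function.uncurry F)) :
    Tendsto (fun h : ℝ≥0 => ((h : ℝ) : ℂ)⁻¹ • ∫ s in (0 : ℝ)..h, F h s) (𝓝[>] 0)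
      (𝓝 (F 0 0)) := by
  have hc : Continuous fun h : ℝ≥0 => ∫ u in (0 : ℝ)..1, F h (h * u) :=
    intervalIntegral.continuous_parametric_intervalIntegral_of_continuous'
      (f := fun (h : ℝ≥0) u => F h (h * u))
      (hF.comp (by fun_prop : Continuous fun p : ℝ≥0 × ℝ => ((p.1 : ℝ), (p.1 : ℝ) * p.2))) 0 1
  have h0 := (hc.tendsto 0).mono_left (nhdsWithin_le_nhds (s := Set.Ioi 0))
  simp only [NNReal.coe_zero, zero_mul, intervalIntegral.integral_const, sub_zero, one_smul] at h0
  refine h0.congr' ?_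
  filter_upwards [self_mem_nhdsWithin] with h hh
  have hh' : (h : ℝ) ≠ 0 := by exact_mod_cast (ne_of_gt hh)
  have := intervalIntegral.smul_integral_comp_mul_left (fun s => F h s) (a := 0) (b := 1) (h : ℝ)
  rw [mul_zero, mul_one] at this
  rw [← this, ← Complex.ofReal_inv, Complex.coe_smul, smul_smul, inv_mul_cancel₀ hh', one_smul]

theorem mem_graph_generator_iff {T : ℝ≥0 → H →L[ℂ] H} {x y : H} :
    (x, y) ∈ (generator T).graph ↔ HasOrbitDeriv T x y := by
  rw [LinearPMap.mem_graph_iff]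
  constructor
  · rintro ⟨w, rfl, rfl⟩
    exact hasOrbitDeriv_generator w
  · intro h
    exact ⟨⟨x, y, h⟩, rfl, (hasOrbitDeriv_generator ⟨x, y, h⟩).unique h⟩

theorem generator_eq_iff {T : ℝ≥0 → H →L[ℂ] H} {A : H →ₗ.[ℂ] H} :
    generator T = A ↔ ∀ x y, HasOrbitDeriv T x y ↔ (x, y) ∈ A.graph := by
  constructor
  · rintro rfl x y
    exact mem_graph_generator_iff.symm
  · intro h
    refine LinearPMap.eq_of_eq_graph ?_
    ext ⟨x, y⟩
    rw [mem_graph_generator_iff, h]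

/-- If the difference quotients of two families at `x` differ by a quantity tending to `b`, then
the derivatives at `x` exist simultaneously and differ by `b`. -/
theorem hasOrbitDeriv_iff_of_tendsto_sub {U V : ℝ≥0 → H →L[ℂ] H} {x b : H}
    (h : Tendsto (fun h : ℝ≥0 => ((h : ℝ) : ℂ)⁻¹ • (V h x - U h x)) (𝓝[>] 0) (𝓝 b)) (y : H) :
    HasOrbitDeriv V x y ↔ HasOrbitDeriv U x (y - b) := by
  constructor
  · intro hV
    refine (Tendsto.sub hV h).congr fun r => ?_
    rw [← smul_sub]
    congr 1
    abel
  · intro hU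
    have := Tendsto.add hU h
    rw [sub_add_cancel] at this
    refine this.congr fun r => ?_
    rw [← smul_add]
    congr 1
    abel

namespace IsC0Semigroup

variable {U : ℝ≥0 → H →L[ℂ] H}

theorem add_apply (hU : IsC0Semigroup U) (s t : ℝ≥0) (x : H) : U (s + t) x = U s (U t x) := by
  rw [hU.map_add]; rfl

theorem apply_comm (hU : IsC0Semigroup U) (s t : ℝ≥0) (x : H) :
    U s (U t x) = U t (U s x) := by
  rw [← hU.add_apply, ← hU.add_apply, add_comm]

theorem zero_apply (hU : IsC0Semigroup U) (x : H) : U 0 x = x := by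
  rw [hU.map_zero]; rfl

/-- Uniform boundedness on compact time intervals, by the Banach-Steinhaus theorem. -/
theorem exists_bound_of_le [CompleteSpace H] (hU : IsC0Semigroup U) (t : ℝ≥0) :
    ∃ M : ℝ, 1 ≤ M ∧ ∀ s ≤ t, ‖U s‖ ≤ M := by
  obtain ⟨C, hC⟩ := banach_steinhaus (g := fun s : Set.Icc 0 t => U s) fun x => by
    obtain ⟨C, hC⟩ := (isCompact_Icc (a := (0 : ℝ≥0)) (b := t)).exists_bound_of_continuousOn
      (hU.continuous_orbit x).continuousOn
    exact ⟨C, fun s => hC s s.2⟩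
  exact ⟨max 1 C, le_max_left _ _, fun s hs => (hC ⟨s, zero_le, hs⟩).trans (le_max_right _ _)⟩

/-- Exponential growth bound, from boundedness by `M` on `[0, 1]`: `‖U t‖ ≤ M ^ (⌊t⌋ + 1)`. -/
theorem exists_exp_bound [CompleteSpace H] (hU : IsC0Semigroup U) :
    ∃ M ω : ℝ, 1 ≤ M ∧ ∀ t, ‖U t‖ ≤ M * Real.exp (ω * t) := by
  obtain ⟨M, hM1, hM⟩ := hU.exists_bound_of_le 1
  have hM0 : 0 < M := by linarith
  have key : ∀ n : ℕ, ∀ t : ℝ≥0, t ≤ n + 1 → ‖U t‖ ≤ M ^ (n + 1) := by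
    intro n
    induction n with
    | zero => intro t ht; simpa using hM t (by simpa using ht)
    | succ n ih =>
      intro t ht
      rcases le_total t 1 with h | h
      · exact (hM t h).trans (le_self_pow₀ hM1 (by omega))
      · have e : t = (t - 1) + 1 := (tsub_add_cancel_of_le h).symm
        rw [e, hU.map_add, pow_succ M (n + 1)]
        refine (ContinuousLinearMap.opNorm_comp_le _ _).trans ?_
        refine mul_le_mul (ih _ ?_) (hM 1 le_rfl) (norm_nonneg _) (by positivity)
        rw [tsub_le_iff_right]
        exact_mod_cast ht
  refine ⟨M, Real.log M, hM1, fun t => (key ⌊t⌋₊ t (Nat.lt_floor_add_one t).le).trans ?_⟩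
  rw [pow_succ, mul_comm]
  refine mul_le_mul_of_nonneg_left ?_ hM0.le
  rw [← Real.rpow_natCast, Real.rpow_def_of_pos hM0]
  refine Real.exp_le_exp.2 (mul_le_mul_of_nonneg_left ?_ (Real.log_nonneg hM1))
  exact_mod_cast Nat.floor_le (zero_le (a := t))

/-- Strong continuity and local boundedness give joint continuity. -/
theorem continuous_uncurry [CompleteSpace H] (hU : IsC0Semigroup U) :
    Continuous fun p : ℝ≥0 × H => U p.1 p.2 := by
  rw [continuous_iff_continuousAt]
  rintro ⟨t, x⟩
  obtain ⟨M, hM1, hM⟩ := hU.exists_bound_of_le (t + 1)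
  have h1 : Tendsto (fun p : ℝ≥0 × H => U p.1 (p.2 - x)) (𝓝 (t, x)) (𝓝 0) := by
    have h2 : Tendsto (fun p : ℝ≥0 × H => M * ‖p.2 - x‖) (𝓝 (t, x)) (𝓝 0) := by
      have : Continuous fun p : ℝ≥0 × H => M * ‖p.2 - x‖ := by fun_prop
      simpa using this.tendsto (t, x)
    refine squeeze_zero_norm' ?_ h2
    have : ∀ᶠ p : ℝ≥0 × H in 𝓝 (t, x), p.1 < t + 1 :=
      continuous_fst.continuousAt.eventually_lt continuousAt_const (by simp)
    filter_upwards [this] with p hp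
    exact (U p.1).le_of_opNorm_le (hM _ hp.le) _
  have h3 : Tendsto (fun p : ℝ≥0 × H => U p.1 x) (𝓝 (t, x)) (𝓝 (U t x)) :=
    ((hU.continuous_orbit x).comp continuous_fst).tendsto (t, x)
  have := h1.add h3
  rw [zero_add] at this
  refine this.congr fun p => ?_
  simp

theorem continuous_apply [CompleteSpace H] (hU : IsC0Semigroup U) {X : Type*} [TopologicalSpace X]
    {t : X → ℝ≥0} {f : X → H} (ht : Continuous t) (hf : Continuous f) :
    Continuous fun a => U (t a) (f a) :=
  hU.continuous_uncurry.comp (ht.prodMk hf)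

theorem continuous_orbit_real (hU : IsC0Semigroup U) (x : H) :
    Continuous fun s : ℝ => U s.toNNReal x :=
  (hU.continuous_orbit x).comp continuous_real_toNNReal

theorem norm_integral_orbit_le {t : ℝ≥0} {M : ℝ} (hM : ∀ s ≤ t, ‖U s‖ ≤ M) (x : H) :
    ‖∫ s in (0 : ℝ)..t, U s.toNNReal x‖ ≤ M * t * ‖x‖ := by
  refine (intervalIntegral.norm_integral_le_of_norm_le_const (C := M * ‖x‖) ?_).trans_eq ?_
  · intro s hs
    rw [Set.uIoc_of_le t.coe_nonneg] at hs
    exact (U _).le_of_opNorm_le (hM _ (Real.toNNReal_le_iff_le_coe.2 hs.2)) _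
  · rw [sub_zero, NNReal.abs_eq]
    ring

/-- A semigroup that is bounded near `0` and whose orbits tend to their starting point along a
dense set is strongly continuous. -/
theorem of_dense [CompleteSpace H] {U : ℝ≥0 → H →L[ℂ] H} (h0 : U 0 = 1)
    (hadd : ∀ s t, U (s + t) = U s ∘L U t)
    (hb : ∀ t, ∃ M : ℝ, ∀ s ≤ t, ‖U s‖ ≤ M) {D : Set H} (hD : Dense D)
    (hc : ∀ x ∈ D, Tendsto (fun t => U t x) (𝓝 0) (𝓝 x)) : IsC0Semigroup U := by
  have hc0 : ∀ x, Tendsto (fun t => U t x) (𝓝 0) (𝓝 x) := by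
    intro x
    obtain ⟨M, hM⟩ := hb 1
    have hM0 : 0 ≤ M := (norm_nonneg _).trans (hM 0 zero_le)
    rw [Metric.tendsto_nhds]
    intro ε hε
    obtain ⟨y, hxy, hyD⟩ := Metric.dense_iff.1 hD x (ε / (2 * (M + 1))) (by positivity)
    have h1 : ∀ᶠ t : ℝ≥0 in 𝓝 0, t < 1 := Iio_mem_nhds one_pos
    filter_upwards [h1, Metric.tendsto_nhds.1 (hc y hyD) (ε / 2) (by positivity)] with t ht hty
    rw [mem_ball_iff_norm'] at hxy
    rw [dist_eq_norm] at hty ⊢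
    have e : U t x - x = U t (x - y) + (U t y - y) - (x - y) := by rw [map_sub]; abel
    have h2 : ‖U t (x - y)‖ ≤ M * ‖x - y‖ := (U t).le_of_opNorm_le (hM _ ht.le) _
    have h3 : (M + 1) * ‖x - y‖ < ε / 2 := by
      rw [lt_div_iff₀ (by positivity)] at hxy
      linarith
    calc ‖U t x - x‖ ≤ ‖U t (x - y)‖ + ‖U t y - y‖ + ‖x - y‖ := by
          rw [e]; exact (norm_sub_le _ _).trans (by gcongr; exact norm_add_le _ _)
      _ < ε := by linarith
  refine ⟨h0, hadd, fun x => continuous_iff_continuousAt.2 fun t => ?_⟩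
  obtain ⟨M, hM⟩ := hb (t + 1)
  -- Both one-sided estimates at once: `s` and `t` differ by `nndist s t`.
  have key : ∀ s ≤ t + 1, ‖U s x - U t x‖ ≤ M * ‖U (nndist s t) x - x‖ := by
    intro s hs
    rcases le_total s t with h | h
    · have e : t = s + nndist s t := by
        rw [NNReal.nndist_eq, tsub_eq_zero_of_le h, max_eq_right zero_le,
          add_tsub_cancel_of_le h]
      rw [norm_sub_rev]
      conv_lhs => rw [e, hadd]
      rw [ContinuousLinearMap.comp_apply, ← map_sub]
      exact (U s).le_of_opNorm_le (hM _ hs) _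
    · have e : s = t + nndist s t := by
        rw [NNReal.nndist_eq, tsub_eq_zero_of_le h, max_eq_left zero_le,
          add_tsub_cancel_of_le h]
      conv_lhs => rw [e, hadd]
      rw [ContinuousLinearMap.comp_apply, ← map_sub]
      exact (U t).le_of_opNorm_le (hM _ le_self_add) _
  have hlim : Tendsto (fun s => M * ‖U (nndist s t) x - x‖) (𝓝 t) (𝓝 0) := by
    have h1 : Tendsto (fun s => nndist s t) (𝓝 t) (𝓝 0) := by
      have : Continuous fun s : ℝ≥0 => nndist s t := by fun_prop
      simpa using this.tendsto t
    simpa using (((hc0 x).comp h1).sub_const x).norm.const_mul M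
  rw [ContinuousAt, tendsto_iff_norm_sub_tendsto_zero]
  refine squeeze_zero' (.of_forall fun _ => norm_nonneg _) ?_ hlim
  filter_upwards [Iio_mem_nhds (lt_add_one t)] with s hs
  exact key s (le_of_lt hs)

end IsC0Semigroup

/-! ### The integrated semigroup and the generator -/

namespace IsC0Semigroup

variable [CompleteSpace H] {U : ℝ≥0 → H →L[ℂ] H}

/-- The integrated semigroup `x ↦ ∫ s in 0..t, U s x`, as a bounded operator. The semigroup is
extended to a real integration variable by truncation at `0`. -/
def integrated (hU : IsC0Semigroup U) (t : ℝ≥0) : H →L[ℂ] H :=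
  LinearMap.mkContinuousOfExistsBound
    { toFun := fun x => ∫ s in (0 : ℝ)..t, U s.toNNReal x
      map_add' := fun x y => by
        refine (intervalIntegral.integral_congr fun s _ => _root_.map_add (U s.toNNReal) x y).trans ?_
        exact intervalIntegral.integral_add ((hU.continuous_orbit_real x).intervalIntegrable _ _)
          ((hU.continuous_orbit_real y).intervalIntegrable _ _)
      map_smul' := fun c x => by
        refine (intervalIntegral.integral_congr fun s _ => map_smul (U s.toNNReal) c x).trans ?_
        exact intervalIntegral.integral_smul _ _ } <| by
    obtain ⟨M, -, hM⟩ := hU.exists_bound_of_le t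
    refine ⟨M * t, fun x => ?_⟩
    exact norm_integral_orbit_le hM x

theorem integrated_apply (hU : IsC0Semigroup U) (t : ℝ≥0) (x : H) :
    hU.integrated t x = ∫ s in (0 : ℝ)..t, U s.toNNReal x := rfl

theorem norm_integrated_le (hU : IsC0Semigroup U) {t : ℝ≥0} {M : ℝ} (hM : ∀ s ≤ t, ‖U s‖ ≤ M) :
    ‖hU.integrated t‖ ≤ M * t := by
  have hM0 : 0 ≤ M := (norm_nonneg _).trans (hM 0 zero_le)
  refine ContinuousLinearMap.opNorm_le_bound _ (by positivity) fun x => ?_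
  exact norm_integral_orbit_le hM x

theorem integrated_apply_comm (hU : IsC0Semigroup U) (s t : ℝ≥0) (x : H) :
    hU.integrated t (U s x) = U s (hU.integrated t x) := by
  rw [integrated_apply, integrated_apply, ← ContinuousLinearMap.intervalIntegral_comp_comm _
    ((hU.continuous_orbit_real x).intervalIntegrable _ _)]
  simp_rw [hU.apply_comm]

/-- The cocycle identity `∫₀ˢ⁺ᵗ U = ∫₀ˢ U + U(s) ∫₀ᵗ U`. -/
theorem integrated_add (hU : IsC0Semigroup U) (s t : ℝ≥0) (x : H) :
    hU.integrated (s + t) x = hU.integrated s x + U s (hU.integrated t x) := by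
  have hi := fun a b => (hU.continuous_orbit_real x).intervalIntegrable
    (μ := MeasureTheory.volume) a b
  rw [integrated_apply, integrated_apply, integrated_apply,
    ← intervalIntegral.integral_add_adjacent_intervals (hi 0 s) (hi _ _),
    ← ContinuousLinearMap.intervalIntegral_comp_comm _ (hi _ _)]
  congr 1
  have := intervalIntegral.integral_comp_add_left (fun r : ℝ => U r.toNNReal x)
    (a := 0) (b := t) (s : ℝ)
  rw [add_zero] at this
  rw [NNReal.coe_add, ← this]
  refine intervalIntegral.integral_congr fun r hr => ?_
  rw [Set.uIcc_of_le t.coe_nonneg] at hr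
  rw [Real.toNNReal_add s.coe_nonneg hr.1, Real.toNNReal_coe, hU.add_apply]

/-- The roles of `s` and `t` in `(U(s) - 1) ∫₀ᵗ U` can be exchanged, so that difference quotients of
an integrated orbit become means of the orbit over short intervals. -/
theorem sub_integrated_comm (hU : IsC0Semigroup U) (s t : ℝ≥0) (x : H) :
    U s (hU.integrated t x) - hU.integrated t x =
      U t (hU.integrated s x) - hU.integrated s x := by
  have h1 := hU.integrated_add s t x
  have h2 := hU.integrated_add t s x
  rw [add_comm t s, h1] at h2
  rw [sub_eq_sub_iff_add_eq_add, add_comm, h2, add_comm]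

theorem tendsto_inv_smul_integrated (hU : IsC0Semigroup U) (x : H) :
    Tendsto (fun h : ℝ≥0 => ((h : ℝ) : ℂ)⁻¹ • hU.integrated h x) (𝓝[>] 0) (𝓝 x) := by
  have := tendsto_inv_smul_integral (F := fun _ s : ℝ => U s.toNNReal x)
    ((hU.continuous_orbit_real x).comp continuous_snd)
  rwa [Real.toNNReal_zero, hU.zero_apply] at this

theorem hasOrbitDeriv_integrated (hU : IsC0Semigroup U) (t : ℝ≥0) (x : H) :
    HasOrbitDeriv U (hU.integrated t x) (U t x - x) := by
  have h1 := hU.tendsto_inv_smul_integrated x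
  have h2 := (((U t).continuous.tendsto x).comp h1).sub h1
  refine h2.congr fun h => ?_
  rw [Function.comp_apply, hU.sub_integrated_comm, smul_sub, map_smul]

theorem integrated_apply_of_hasOrbitDeriv (hU : IsC0Semigroup U) {x y : H}
    (h : HasOrbitDeriv U x y) (t : ℝ≥0) : hU.integrated t y = U t x - x := by
  refine tendsto_nhds_unique (((hU.integrated t).continuous.tendsto y).comp h)
    ((hU.hasOrbitDeriv_integrated t x).congr fun r => ?_)
  rw [Function.comp_apply, map_smul, map_sub, hU.integrated_apply_comm]

theorem dense_generator_domain (hU : IsC0Semigroup U) :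
    Dense ((generator U).domain : Set H) := fun x =>
  mem_closure_of_tendsto (hU.tendsto_inv_smul_integrated x) <| .of_forall fun t =>
    Submodule.smul_mem _ _ ⟨_, hU.hasOrbitDeriv_integrated t x⟩

theorem isClosed_generator (hU : IsC0Semigroup U) : (generator U).IsClosed := by
  -- The graph is cut out by the closed conditions `∫₀ᵗ U(s) y ds = U(t) x - x`.
  have key : ((generator U).graph : Set (H × H)) =
      ⋂ t, {p | hU.integrated t p.2 = U t p.1 - p.1} := by
    ext ⟨x, y⟩
    rw [SetLike.mem_coe, mem_graph_generator_iff, Set.mem_iInter]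
    refine ⟨fun h t => hU.integrated_apply_of_hasOrbitDeriv h t, fun h => ?_⟩
    exact (hU.tendsto_inv_smul_integrated y).congr fun t => by rw [h t]
  rw [LinearPMap.IsClosed, key]
  exact isClosed_iInter fun t => isClosed_eq (by fun_prop) (by fun_prop)

/-- A strongly continuous semigroup is determined by its generator: the interpolation
`s ↦ S (t - s) (T s x)` between the two orbits has vanishing right derivative when `x` is in the
domain of the common generator. -/
theorem eq_of_generator_eq {S T : ℝ≥0 → H →L[ℂ] H} (hS : IsC0Semigroup S) (hT : IsC0Semigroup T)
    (h : generator S = generator T) : S = T := by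
  have hd : ∀ x y, HasOrbitDeriv T x y → HasOrbitDeriv S x y := fun x y hxy => by
    rwa [← mem_graph_generator_iff, h, mem_graph_generator_iff]
  funext t
  refine ContinuousLinearMap.ext fun x => congrFun (Continuous.ext_on hT.dense_generator_domain
    (S t).continuous (T t).continuous ?_) x
  rintro x ⟨y, hy⟩
  let f : ℝ → H := fun s => S (t - s.toNNReal) (T s.toNNReal x)
  have hf : Continuous f :=
    hS.continuous_apply (by fun_prop) (hT.continuous_orbit_real x)
  have hf' : ∀ s ∈ Set.Ico (0 : ℝ) t, HasDerivWithinAt f 0 (Set.Ici s) s := by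
    rintro s ⟨hs0, hst⟩
    lift s to ℝ≥0 using hs0
    rw [NNReal.coe_lt_coe] at hst
    have h1 : HasOrbitDeriv T (T s x) (T s y) := by
      refine (((T s).continuous.tendsto y).comp hy).congr fun r => ?_
      rw [Function.comp_apply, map_smul, map_sub, hT.apply_comm]
    have h2 := Tendsto.sub h1 (hd _ _ h1)
    rw [sub_self] at h2
    have h3 : Tendsto (fun r : ℝ≥0 => t - (s + r)) (𝓝[>] 0) (𝓝 (t - s)) := by
      have : Continuous fun r : ℝ≥0 => t - (s + r) := by fun_prop
      simpa using (this.tendsto 0).mono_left nhdsWithin_le_nhds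
    have h4 := (hS.continuous_uncurry.tendsto (t - s, 0)).comp (h3.prodMk_nhds h2)
    simp only [_root_.map_zero] at h4
    rw [hasDerivWithinAt_iff_tendsto_slope, Set.Ici_sdiff_left]
    have h5 : Tendsto (fun r : ℝ => (r - s).toNNReal) (𝓝[>] (s : ℝ)) (𝓝[>] 0) := by
      refine tendsto_nhdsWithin_iff.2 ⟨?_, ?_⟩
      · have : Continuous fun r : ℝ => (r - s).toNNReal := by fun_prop
        simpa using (this.tendsto s).mono_left nhdsWithin_le_nhds
      · filter_upwards [self_mem_nhdsWithin] with r hr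
        simpa using hr
    refine (h4.comp h5).congr' ?_
    filter_upwards [Ioo_mem_nhdsGT (NNReal.coe_lt_coe.2 hst)] with r hr
    obtain ⟨hsr, hrt⟩ := hr
    -- The difference quotient at `s + q` is `S (t - (s + q))` applied to the difference of the
    -- quotients of `T` and `S` at `T s x`; both quotients tend to the same limit.
    obtain ⟨q, rfl⟩ : ∃ q : ℝ≥0, r = s + q :=
      ⟨(r - s).toNNReal, by rw [Real.coe_toNNReal _ (by linarith)]; ring⟩
    have hq : s + q ≤ t := by exact_mod_cast hrt.le
    have e : t - s = (t - (s + q)) + q := by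
      rw [← tsub_tsub, tsub_add_cancel_of_le (le_tsub_of_add_le_left hq)]
    simp only [Function.comp_apply, slope_def_module, f]
    rw [← NNReal.coe_add, Real.toNNReal_coe, Real.toNNReal_coe, NNReal.coe_add,
      add_sub_cancel_left, Real.toNNReal_coe, e, hS.add_apply, add_comm s q, hT.add_apply,
      ← smul_sub, map_smul, ← Complex.ofReal_inv, Complex.coe_smul, ← map_sub]
    congr 2
    abel
  have := constant_of_has_deriv_right_zero hf.continuousOn hf' t (Set.right_mem_Icc.2 t.2)
  simp only [f, Real.toNNReal_coe, tsub_self, Real.toNNReal_zero, tsub_zero, hS.zero_apply,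
    hT.zero_apply] at this
  exact this.symm

/-! ### The adjoint semigroup -/

/-- Integration commutes with taking adjoints; continuity of the adjoint orbits is needed for the
left-hand integral to exist. -/
theorem integrated_adjoint {V : ℝ≥0 → H →L[ℂ] H} (hU : IsC0Semigroup U) (hV : IsC0Semigroup V)
    (h : ∀ t, V t = ContinuousLinearMap.adjoint (U t)) (t : ℝ≥0) :
    hV.integrated t = ContinuousLinearMap.adjoint (hU.integrated t) := by
  ext y
  refine ext_inner_right ℂ fun x => ?_
  rw [ContinuousLinearMap.adjoint_inner_left, ← inner_conj_symm, integrated_apply,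
    integrated_apply]
  have h1 := (innerSL ℂ x).intervalIntegral_comp_comm (μ := MeasureTheory.volume)
    ((hV.continuous_orbit_real y).intervalIntegrable 0 t)
  have h2 := (innerSL ℂ y).intervalIntegral_comp_comm (μ := MeasureTheory.volume)
    ((hU.continuous_orbit_real x).intervalIntegrable 0 t)
  simp only [innerSL_apply_apply] at h1 h2
  rw [← h1, ← h2, ← intervalIntegral.intervalIntegral_conj]
  simp [h, ContinuousLinearMap.adjoint_inner_left]

/-- On a Hilbert space the adjoint of a strongly continuous semigroup is strongly continuous. -/
theorem adjoint (hU : IsC0Semigroup U) :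
    IsC0Semigroup fun t => ContinuousLinearMap.adjoint (U t) := by
  -- The vectors with continuous adjoint orbit form a subspace containing the ranges of all
  -- `(∫₀ᵗ U(s) ds)†`; a vector orthogonal to these ranges is the limit of
  -- `t⁻¹ ∫₀ᵗ U(s) w ds = 0`.
  let K : Submodule ℂ H :=
    { carrier := {y | Tendsto (fun t => ContinuousLinearMap.adjoint (U t) y) (𝓝 0) (𝓝 y)}
      zero_mem' := by simp
      add_mem' := fun {a b} ha hb => 
        (Tendsto.add ha hb).congr fun t => (_root_.map_add _ a b).symm
      smul_mem' := fun c a ha => 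
        (Tendsto.const_smul ha c).congr fun t => (map_smul _ c a).symm }
  have hK : ∀ t y, ContinuousLinearMap.adjoint (hU.integrated t) y ∈ K := by
    intro t y
    obtain ⟨M, hM1, hM⟩ := hU.exists_bound_of_le 1
    have hlim : Tendsto (fun h : ℝ≥0 => (‖U t‖ + 1) * (M * h) * ‖y‖) (𝓝 0) (𝓝 0) := by
      have : Continuous fun h : ℝ≥0 => (‖U t‖ + 1) * (M * h) * ‖y‖ := by fun_prop
      simpa using this.tendsto 0
    refine tendsto_iff_norm_sub_tendsto_zero.2 (squeeze_zero' (.of_forall fun _ => norm_nonneg _)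
      ?_ hlim)
    filter_upwards [Iio_mem_nhds one_pos] with h hh
    have e : ContinuousLinearMap.adjoint (U h) (ContinuousLinearMap.adjoint (hU.integrated t) y) -
        ContinuousLinearMap.adjoint (hU.integrated t) y =
        ContinuousLinearMap.adjoint ((U t - 1) ∘L hU.integrated h) y := by
      refine ext_inner_right ℂ fun x => ?_
      simp only [inner_sub_left, ContinuousLinearMap.adjoint_inner_left,
        hU.integrated_apply_comm, ContinuousLinearMap.comp_apply, sub_apply,
        one_apply_eq_self, ← inner_sub_right]
      rw [hU.sub_integrated_comm]
    rw [e]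
    refine ContinuousLinearMap.le_of_opNorm_le _ ?_ _
    rw [LinearIsometryEquiv.norm_map]
    refine (ContinuousLinearMap.opNorm_comp_le _ _).trans ?_
    gcongr
    · refine (norm_sub_le _ _).trans ?_
      gcongr
      exact ContinuousLinearMap.norm_id_le
    · exact hU.norm_integrated_le fun s hs => hM s (hs.trans hh.le)
  have hKd : Dense (K : Set H) := by
    rw [Submodule.dense_iff_topologicalClosure_eq_top, Submodule.topologicalClosure_eq_top_iff,
      Submodule.eq_bot_iff]
    intro w hw
    have h0 : ∀ t, hU.integrated t w = 0 := fun t => ext_inner_left ℂ fun y => by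
      rw [inner_zero_right, ← ContinuousLinearMap.adjoint_inner_left]
      exact (Submodule.mem_orthogonal _ _).1 hw _ (hK t y)
    refine tendsto_nhds_unique (hU.tendsto_inv_smul_integrated w) ?_
    simp [h0]
  refine of_dense ?_ ?_ ?_ hKd fun x hx => hx
  · rw [hU.map_zero]
    exact ContinuousLinearMap.adjoint_id
  · intro s t
    rw [add_comm, hU.map_add, ContinuousLinearMap.adjoint_comp]
  · intro t
    obtain ⟨M, -, hM⟩ := hU.exists_bound_of_le t
    exact ⟨M, fun s hs => by rw [LinearIsometryEquiv.norm_map]; exact hM s hs⟩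

theorem generator_adjoint (hU : IsC0Semigroup U) :
    generator (fun t => ContinuousLinearMap.adjoint (U t)) = (generator U).adjoint := by
  have hd := hU.dense_generator_domain
  rw [generator_eq_iff]
  intro y y'
  rw [LinearPMap.mem_graph_iff]
  constructor
  · intro h
    have key : ∀ x : (generator U).domain, inner ℂ y' (x : H) = inner ℂ y (generator U x) := by
      intro x
      refine tendsto_nhds_unique (Tendsto.inner (𝕜 := ℂ) h tendsto_const_nhds)
        ((Tendsto.inner (𝕜 := ℂ) tendsto_const_nhds (hasOrbitDeriv_generator x)).congr
        fun r => ?_)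
      simp only [inner_smul_left, inner_smul_right, inner_sub_left, inner_sub_right,
        ContinuousLinearMap.adjoint_inner_left, map_inv₀, Complex.conj_ofReal]
    exact ⟨⟨y, LinearPMap.mem_adjoint_domain_of_exists y ⟨y', key⟩⟩, rfl,
      LinearPMap.adjoint_apply_eq hd _ key⟩
  -- For `y ∈ D(L†)` one has `U(h)† y - y = ∫₀ʰ U(s)† L† y ds`, tested against `x` through
  -- `L ∫₀ʰ U(s) x ds = U(h) x - x`.
  · rintro ⟨y, rfl, rfl⟩
    refine (hU.adjoint.tendsto_inv_smul_integrated ((generator U).adjoint y)).congr fun h => ?_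
    congr 1
    refine ext_inner_right ℂ fun x => ?_
    rw [integrated_adjoint hU hU.adjoint (fun _ => rfl),
      ContinuousLinearMap.adjoint_inner_left, inner_sub_left,
      ContinuousLinearMap.adjoint_inner_left, ← inner_sub_right]
    have hx : hU.integrated h x ∈ (generator U).domain := ⟨_, hU.hasOrbitDeriv_integrated h x⟩
    rw [LinearPMap.adjoint_isFormalAdjoint hd y ⟨_, hx⟩]
    congr 1
    exact (hasOrbitDeriv_generator ⟨_, hx⟩).unique (hU.hasOrbitDeriv_integrated h x)

end IsC0Semigroup

/-! ### Bounded perturbations -/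

namespace IsC0Semigroup

variable {U : ℝ≥0 → H →L[ℂ] H}

theorem rescale (hU : IsC0Semigroup U) (a : ℝ) :
    IsC0Semigroup fun t => ((Real.exp (a * t) : ℝ) : ℂ) • U t where
  map_zero := by simp [hU.map_zero]
  map_add s t := by
    ext x
    simp [hU.add_apply, mul_add, Complex.exp_add, smul_smul, mul_comm]
  continuous_orbit x := by
    have := hU.continuous_orbit x
    simp only [smul_apply]
    fun_prop

/-- Multiplying a semigroup by `exp (a t)` shifts its generator by `a`. -/
theorem hasOrbitDeriv_rescale_iff (hU : IsC0Semigroup U) (a : ℝ) (x y : H) :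
    HasOrbitDeriv (fun t => ((Real.exp (a * t) : ℝ) : ℂ) • U t) x y ↔
      HasOrbitDeriv U x (y - (a : ℂ) • x) := by
  refine hasOrbitDeriv_iff_of_tendsto_sub ?_ y
  have h1 : HasDerivAt (fun h : ℝ => Real.exp (a * h)) a 0 := by
    simpa using ((hasDerivAt_id (0 : ℝ)).const_mul a).exp
  have h2 : Tendsto (fun h : ℝ≥0 => (h : ℝ)) (𝓝[>] 0) (𝓝[≠] 0) := by
    refine tendsto_nhdsWithin_iff.2 ⟨?_, ?_⟩
    · simpa using (NNReal.continuous_coe.tendsto 0).mono_left nhdsWithin_le_nhds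
    · filter_upwards [self_mem_nhdsWithin] with r hr
      simpa using (ne_of_gt hr : r ≠ 0)
  have h3 := (Complex.continuous_ofReal.tendsto a).comp (h1.tendsto_slope.comp h2)
  have h4 : Tendsto (fun h => U h x) (𝓝[>] 0) (𝓝 x) := by
    simpa [hU.zero_apply] using ((hU.continuous_orbit x).tendsto 0).mono_left nhdsWithin_le_nhds
  refine (h3.smul h4).congr fun h => ?_
  simp [slope_def_field, sub_smul, smul_sub, smul_smul, div_eq_inv_mul, mul_sub]

/-- The convolution `t ↦ ∫ s in 0..t, U (t - s) (f s)`. The integration variable is real; it and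
`t - s` are nonnegative on the range of integration, so the truncations have no effect. -/
def convolution (U : ℝ≥0 → H →L[ℂ] H) (f : ℝ≥0 → H) (t : ℝ≥0) : H :=
  ∫ s in (0 : ℝ)..t, U ((t : ℝ) - s).toNNReal (f s.toNNReal)

theorem norm_convolution_le {M c : ℝ} (hc : 0 < c)
    (hM : ∀ t, ‖U t‖ ≤ M * Real.exp (-c * t)) {f : ℝ≥0 → H} {C : ℝ}
    (hf : ∀ t, ‖f t‖ ≤ C) (t : ℝ≥0) : ‖convolution U f t‖ ≤ M * C / c := by
  have hC : 0 ≤ C := (norm_nonneg _).trans (hf 0)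
  have hM0 : 0 ≤ M := by simpa using (norm_nonneg _).trans (hM 0)
  have h1 : ‖convolution U f t‖ ≤ ∫ s in (0 : ℝ)..t, M * C * Real.exp (c * s + -c * t) := by
    refine intervalIntegral.norm_integral_le_of_norm_le t.coe_nonneg (.of_forall fun s hs => ?_)
      (Continuous.intervalIntegrable (by fun_prop) _ _)
    refine ((U _).le_of_opNorm_le_of_le (hM _) (hf _)).trans_eq ?_
    rw [Real.coe_toNNReal _ (sub_nonneg.2 hs.2)]
    ring_nf
  refine h1.trans ?_
  rw [intervalIntegral.integral_const_mul,
    intervalIntegral.integral_comp_mul_add Real.exp hc.ne', integral_exp, mul_div_assoc,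
    div_eq_mul_inv, mul_assoc]
  gcongr
  rw [smul_eq_mul, mul_comm]
  have h2 : Real.exp (c * t + -c * t) = 1 := by simp
  rw [h2]
  have := Real.exp_pos (c * 0 + -c * t)
  have h3 : 0 < c⁻¹ := inv_pos.2 hc
  nlinarith

variable [CompleteSpace H]

theorem continuous_convolution_integrand (hU : IsC0Semigroup U) {f : ℝ≥0 → H}
    (hf : Continuous f) :
    Continuous (Function.uncurry fun t s : ℝ => U (t - s).toNNReal (f s.toNNReal)) :=
  hU.continuous_apply (by fun_prop) (hf.comp (by fun_prop))

theorem intervalIntegrable_convolution_integrand (hU : IsC0Semigroup U) {f : ℝ≥0 → H}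
    (hf : Continuous f) (t a b : ℝ) :
    IntervalIntegrable (fun s : ℝ => U (t - s).toNNReal (f s.toNNReal)) MeasureTheory.volume a b :=
  ((hU.continuous_convolution_integrand hf).comp
    (by fun_prop : Continuous fun s : ℝ => (t, s))).intervalIntegrable a b

theorem continuous_convolution (hU : IsC0Semigroup U) {f : ℝ≥0 → H} (hf : Continuous f) :
    Continuous (convolution U f) :=
  intervalIntegral.continuous_parametric_intervalIntegral_of_continuous
    (f := fun (t : ℝ≥0) s => U ((t : ℝ) - s).toNNReal (f s.toNNReal))
    ((hU.continuous_convolution_integrand hf).comp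
      (by fun_prop : Continuous fun p : ℝ≥0 × ℝ => ((p.1 : ℝ), p.2))) NNReal.continuous_coe

/-- Splitting the integral at `s` turns the convolution at time `t + s` into a propagated part and
the convolution of the shifted function; this yields the semigroup law for solutions of the
Volterra equation. -/
theorem convolution_add_time (hU : IsC0Semigroup U) {f : ℝ≥0 → H} (hf : Continuous f)
    (t s : ℝ≥0) :
    convolution U f (t + s) = U t (convolution U f s) + convolution U (fun r => f (r + s)) t := by
  have hi := fun a b => hU.intervalIntegrable_convolution_integrand hf ((t + s : ℝ≥0) : ℝ) a b
  rw [convolution, convolution, convolution,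
    ← intervalIntegral.integral_add_adjacent_intervals (hi 0 s) (hi _ _),
    ← ContinuousLinearMap.intervalIntegral_comp_comm _
      (hU.intervalIntegrable_convolution_integrand hf _ _ _)]
  congr 1
  · refine intervalIntegral.integral_congr fun r hr => ?_
    rw [Set.uIcc_of_le s.coe_nonneg] at hr
    rw [← hU.add_apply, NNReal.coe_add, add_sub_assoc,
      Real.toNNReal_add t.coe_nonneg (sub_nonneg.2 hr.2), Real.toNNReal_coe]
  · have := intervalIntegral.integral_comp_add_right
      (fun r : ℝ => U (((t + s : ℝ≥0) : ℝ) - r).toNNReal (f r.toNNReal)) (a := 0) (b := t) (s : ℝ)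
    rw [zero_add, ← NNReal.coe_add] at this
    rw [← this]
    refine intervalIntegral.integral_congr fun r hr => ?_
    rw [Set.uIcc_of_le t.coe_nonneg] at hr
    rw [Real.toNNReal_add hr.1 s.coe_nonneg, Real.toNNReal_coe, NNReal.coe_add,
      add_sub_add_right_eq_sub]

theorem tendsto_inv_smul_convolution (hU : IsC0Semigroup U) {f : ℝ≥0 → H} (hf : Continuous f) :
    Tendsto (fun h : ℝ≥0 => ((h : ℝ) : ℂ)⁻¹ • convolution U f h) (𝓝[>] 0) (𝓝 (f 0)) := by
  have := tendsto_inv_smul_integral (hU.continuous_convolution_integrand hf)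
  rwa [sub_zero, Real.toNNReal_zero, hU.zero_apply] at this

open BoundedContinuousFunction in
/-- A bounded perturbation of a sufficiently fast decaying semigroup. The perturbed orbits are the
bounded solutions `w` of the Volterra equation `w = U(·) x + U * (B w)`, whose convolution operator
has norm less than one on the bounded continuous functions. -/
theorem exists_perturbation_of_decay (hU : IsC0Semigroup U) {M c : ℝ} (hc : 0 < c)
    (hM : ∀ t, ‖U t‖ ≤ M * Real.exp (-c * t)) (B : H →L[ℂ] H) (hB : M * ‖B‖ < c) :
    ∃ V : ℝ≥0 → H →L[ℂ] H, IsC0Semigroup V ∧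
      ∀ x y, HasOrbitDeriv V x y ↔ HasOrbitDeriv U x (y - B x) := by
  have hM0 : 0 ≤ M := by simpa using (norm_nonneg _).trans (hM 0)
  have hUM : ∀ t, ‖U t‖ ≤ M := fun t => (hM t).trans <| mul_le_of_le_one_right hM0 <| by
    rw [Real.exp_le_one_iff, neg_mul]
    exact neg_nonpos.2 (mul_nonneg hc.le t.coe_nonneg)
  -- `J x` is the orbit of `x`, and `K w = U * (B w)`.
  let J : H →L[ℂ] (ℝ≥0 →ᵇ H) := LinearMap.mkContinuous
    { toFun := fun x => ofNormedAddCommGroup (fun t => U t x) (hU.continuous_orbit x) (M * ‖x‖)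
        fun t => (U t).le_of_opNorm_le (hUM t) x
      map_add' := fun x y => by ext t; exact _root_.map_add (U t) x y
      map_smul' := fun a x => by ext t; exact map_smul (U t) a x } M
    fun x => norm_ofNormedAddCommGroup_le (hU.continuous_orbit x) (by positivity)
      fun t => (U t).le_of_opNorm_le (hUM t) x
  have hBw : ∀ w : ℝ≥0 →ᵇ H, Continuous fun t => B (w t) := fun w => by fun_prop
  have hKb : ∀ (w : ℝ≥0 →ᵇ H) t, ‖convolution U (fun t => B (w t)) t‖ ≤ M * ‖B‖ / c * ‖w‖ := by
    intro w t
    refine (norm_convolution_le hc hM (C := ‖B‖ * ‖w‖) (fun s => ?_) t).trans_eq (by ring)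
    exact B.le_opNorm_of_le (w.norm_coe_le_norm s)
  let K : (ℝ≥0 →ᵇ H) →L[ℂ] (ℝ≥0 →ᵇ H) := LinearMap.mkContinuous
    { toFun := fun w => ofNormedAddCommGroup (convolution U fun t => B (w t))
        (hU.continuous_convolution (hBw w)) (M * ‖B‖ / c * ‖w‖) (hKb w)
      map_add' := fun v w => by
        ext t
        refine (intervalIntegral.integral_congr fun s _ => ?_).trans
          (intervalIntegral.integral_add
            (hU.intervalIntegrable_convolution_integrand (hBw v) t 0 t)
            (hU.intervalIntegrable_convolution_integrand (hBw w) t 0 t))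
        simp
      map_smul' := fun a w => by
        ext t
        refine (intervalIntegral.integral_congr fun s _ => ?_).trans
          (intervalIntegral.integral_smul a _)
        simp } (M * ‖B‖ / c)
    fun w => norm_ofNormedAddCommGroup_le (hU.continuous_convolution (hBw w)) (by positivity)
      (hKb w)
  have hK : ‖K‖ < 1 := (LinearMap.mkContinuous_norm_le _ (by positivity) _).trans_lt <| by
    rwa [div_lt_one hc]
  obtain ⟨R, hR⟩ := isUnit_one_sub_of_norm_lt_one (R := (ℝ≥0 →ᵇ H) →L[ℂ] (ℝ≥0 →ᵇ H)) (x := K) hK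
  let V : ℝ≥0 → H →L[ℂ] H := fun t => evalCLM ℂ t ∘L (↑R⁻¹ : (ℝ≥0 →ᵇ H) →L[ℂ] (ℝ≥0 →ᵇ H)) ∘L J
  let W : H → ℝ≥0 →ᵇ H := fun x => (↑R⁻¹ : (ℝ≥0 →ᵇ H) →L[ℂ] (ℝ≥0 →ᵇ H)) (J x)
  have hVW : ∀ t x, V t x = W x t := fun t x => rfl
  have hWeq : ∀ x t, W x t = U t x + convolution U (fun s => B (W x s)) t := by
    intro x t
    have h1 : (1 - K) (W x) = J x := by
      rw [← hR]
      exact DFunLike.congr_fun (R.mul_inv) (J x)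
    have h2 := DFunLike.congr_fun h1 t
    exact sub_eq_iff_eq_add.1 h2
  have huniq : ∀ x (w : ℝ≥0 →ᵇ H),
      (∀ t, w t = U t x + convolution U (fun s => B (w s)) t) → w = W x := by
    intro x w hw
    have h1 : (1 - K) w = J x := by
      ext t
      exact sub_eq_iff_eq_add.2 (hw t)
    rw [← hR] at h1
    have h2 := DFunLike.congr_fun (R.inv_mul) w
    exact h2.symm.trans (congrArg (↑R⁻¹ : (ℝ≥0 →ᵇ H) →L[ℂ] (ℝ≥0 →ᵇ H)) h1)
  have hV0 : ∀ x, W x 0 = x := fun x => by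
    rw [hWeq, hU.zero_apply]
    simp [convolution]
  refine ⟨V, ⟨?_, ?_, fun x => (W x).continuous⟩, fun x y => ?_⟩
  · ext x
    exact hV0 x
  · intro t s
    ext x
    -- The shifted solution `W x (· + s)` solves the equation with initial value `W x s`.
    have h := huniq (W x s) ((W x).compContinuous ⟨fun r => r + s, by fun_prop⟩) fun r => by
      change W x (r + s) = U r (W x s) + convolution U (fun q => B (W x (q + s))) r
      rw [hWeq x (r + s), hU.convolution_add_time (hBw _), hU.add_apply, hWeq x s,
        _root_.map_add, add_assoc]
    exact DFunLike.congr_fun h t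
  · refine hasOrbitDeriv_iff_of_tendsto_sub ?_ y
    have := hU.tendsto_inv_smul_convolution (hBw (W x))
    rw [hV0] at this
    refine this.congr fun h => ?_
    rw [hVW, hWeq, add_sub_cancel_left]

/-- The bounded perturbation theorem: if `U` has generator `L` and `B` is bounded, then `L + B`
generates a strongly continuous semigroup. -/
theorem exists_perturbation (hU : IsC0Semigroup U) (B : H →L[ℂ] H) :
    ∃ V : ℝ≥0 → H →L[ℂ] H, IsC0Semigroup V ∧
      ∀ x y, HasOrbitDeriv V x y ↔ HasOrbitDeriv U x (y - B x) := by
  obtain ⟨M, ω, hM1, hM⟩ := hU.exists_exp_bound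
  -- Shift the generator by `-a` so that the decay rate `c` beats the perturbation.
  set c : ℝ := M * ‖B‖ + 1 with hc
  have hc0 : 0 < c := by positivity
  set a : ℝ := ω + c with ha
  obtain ⟨V, hV, hVd⟩ := (hU.rescale (-a)).exists_perturbation_of_decay hc0 (M := M)
    (fun t => by
      rw [norm_smul, Complex.norm_real, Real.norm_of_nonneg (Real.exp_pos _).le]
      refine (mul_le_mul_of_nonneg_left (hM t) (Real.exp_pos _).le).trans_eq ?_
      rw [mul_left_comm, ← Real.exp_add, ha]
      ring_nf) B (by linarith)
  refine ⟨_, hV.rescale a, fun x y => ?_⟩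
  rw [hV.hasOrbitDeriv_rescale_iff, hVd, hU.hasOrbitDeriv_rescale_iff]
  push_cast
  rw [neg_smul, sub_neg_eq_add, sub_right_comm, sub_add_cancel]

end IsC0Semigroup

/-! ### Products with bounded operators and the Mori projection -/

theorem mem_graph_boundedMul_iff {B : H →L[ℂ] H} {A : H →ₗ.[ℂ] H} {x y : H} :
    (x, y) ∈ (boundedMul B A).graph ↔ ∃ l, (x, l) ∈ A.graph ∧ B l = y := by
  simp only [LinearPMap.mem_graph_iff]
  constructor
  · rintro ⟨w, rfl, rfl⟩
    exact ⟨A w, ⟨w, rfl, rfl⟩, rfl⟩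
  · rintro ⟨_, ⟨w, rfl, rfl⟩, rfl⟩
    exact ⟨w, rfl, rfl⟩

theorem mem_graph_mulBounded_iff {B : H →L[ℂ] H} {A : H →ₗ.[ℂ] H} {x y : H} :
    (x, y) ∈ (mulBounded A B).graph ↔ (B x, y) ∈ A.graph := by
  simp only [LinearPMap.mem_graph_iff]
  constructor
  · rintro ⟨w, rfl, rfl⟩
    exact ⟨⟨B w, w.2⟩, rfl, rfl⟩
  · rintro ⟨w, hw, rfl⟩
    have hx : x ∈ (mulBounded A B).domain := by
      rw [mem_mulBounded_domain_iff, ← hw]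
      exact w.2
    exact ⟨⟨x, hx⟩, rfl, by rw [mulBounded_apply]; congr 1; exact Subtype.ext hw.symm⟩

theorem adjoint_boundedMul [CompleteSpace H] {A : H →ₗ.[ℂ] H} (hA : Dense (A.domain : Set H))
    (B : H →L[ℂ] H) :
    (boundedMul B A).adjoint = mulBounded A.adjoint (ContinuousLinearMap.adjoint B) := by
  have hBA : Dense ((boundedMul B A).domain : Set H) := hA
  refine LinearPMap.eq_of_eq_graph ?_
  ext ⟨y, y'⟩
  rw [mem_graph_mulBounded_iff, LinearPMap.adjoint_graph_eq_graph_adjoint hBA,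
    LinearPMap.adjoint_graph_eq_graph_adjoint hA, Submodule.mem_adjoint_iff,
    Submodule.mem_adjoint_iff]
  simp only [mem_graph_boundedMul_iff, forall_exists_index, and_imp,
    ContinuousLinearMap.adjoint_inner_right]
  constructor
  · intro h a b hab
    exact h a (B b) b hab rfl
  · rintro h a _ l hal rfl
    exact h a l hal

theorem closure_eq_of_isClosed {A : H →ₗ.[ℂ] H} (hA : A.IsClosed) : A.closure = A := by
  refine LinearPMap.eq_of_eq_graph ?_
  rw [← hA.isClosable.graph_closure_eq_closure_graph]
  exact IsClosed.submodule_topologicalClosure_eq hA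

theorem moriProjection_self {z : H} (hz : z ≠ 0) : moriProjection z z = z := by
  rw [moriProjection_apply, mul_inv_cancel₀ (inner_self_ne_zero.2 hz), one_smul]

theorem moriProjection_comp_self {z : H} (hz : z ≠ 0) (x : H) :
    moriProjection z (moriProjection z x) = moriProjection z x := by
  conv_lhs => rw [moriProjection_apply z x, map_smul, moriProjection_self hz]
  rw [moriProjection_apply]

theorem adjoint_moriProjection [CompleteSpace H] (z : H) :
    ContinuousLinearMap.adjoint (moriProjection z) = moriProjection z := by
  ext x
  refine ext_inner_right ℂ fun y => ?_
  rw [ContinuousLinearMap.adjoint_inner_left, moriProjection_apply, moriProjection_apply,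
    inner_smul_left, inner_smul_right, map_mul, inner_conj_symm, map_inv₀, inner_conj_symm]
  ring

/-- Since `z` lies in the domain of `L†`, the product `P L` is the restriction of a bounded
operator; hence `Q L = L - P L` is a bounded perturbation of `L`. -/
theorem exists_generatedBy_boundedMul [CompleteSpace H] {U : ℝ≥0 → H →L[ℂ] H}
    (hU : IsC0Semigroup U) {z : H} (hzL : z ∈ (generator U).adjoint.domain) :
    ∃ S : ℝ≥0 → H →L[ℂ] H,
      IsC0SemigroupGeneratedBy S (boundedMul (1 - moriProjection z) (generator U)) := by
  let w : H := (generator U).adjoint ⟨z, hzL⟩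
  let B : H →L[ℂ] H := (inner ℂ z z)⁻¹ • (innerSL ℂ w).smulRight z
  have hB : ∀ x l, HasOrbitDeriv U x l → moriProjection z l = B x := by
    intro x l h
    have hx : x ∈ (generator U).domain := ⟨l, h⟩
    have h1 : inner ℂ w x = inner ℂ z l := by
      rw [← (hasOrbitDeriv_generator ⟨x, hx⟩).unique h]
      exact LinearPMap.adjoint_isFormalAdjoint hU.dense_generator_domain ⟨z, hzL⟩ ⟨x, hx⟩
    simp [B, moriProjection, h1]
  obtain ⟨S, hS, hSd⟩ := hU.exists_perturbation (-B)
  refine ⟨S, hS, generator_eq_iff.2 fun x y => ?_⟩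
  rw [hSd, mem_graph_boundedMul_iff, neg_apply, sub_neg_eq_add]
  simp only [mem_graph_generator_iff, sub_apply, one_apply_eq_self]
  constructor
  · intro h
    exact ⟨_, h, by rw [hB _ _ h, add_sub_cancel_right]⟩
  · rintro ⟨l, h, rfl⟩
    rwa [hB _ _ h, sub_add_cancel]

/-- If the generator of `S` maps into the kernel of a bounded operator `P`, then `P` is constant
along the orbits of `S`. -/
theorem IsC0Semigroup.comp_eq_of_generator [CompleteSpace H] {S : ℝ≥0 → H →L[ℂ] H}
    (hS : IsC0Semigroup S) {P : H →L[ℂ] H} (hP : ∀ x y, HasOrbitDeriv S x y → P y = 0)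
    (t : ℝ≥0) (x : H) : P (S t x) = P x := by
  have := hP _ _ (hS.hasOrbitDeriv_integrated t x)
  rwa [map_sub, sub_eq_zero] at this

end MoriZwanzig

end

theorem mainTheorem7 {H : Type*} [NormedAddCommGroup H] [InnerProductSpace ℂ H] [CompleteSpace H]
    (U : ℝ≥0 → H →L[ℂ] H) (L : H →ₗ.[ℂ] H)
    (hUL : MoriZwanzig.IsC0SemigroupGeneratedBy U L)
    (z : H) (hz : z ≠ 0) (hzL : z ∈ L.adjoint.domain)
    (P Q : H →L[ℂ] H) (hP : P = MoriZwanzig.moriProjection z) (hQ : Q = 1 - P) :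
    -- `QL` is closable, and its closure generates a unique strongly continuous semigroup
    (MoriZwanzig.boundedMul Q L).IsClosable ∧
    (∃! S : ℝ≥0 → H →L[ℂ] H,
      MoriZwanzig.IsC0SemigroupGeneratedBy S (MoriZwanzig.boundedMul Q L).closure) ∧
    -- `L†Q` generates a unique strongly continuous semigroup
    (∃! T : ℝ≥0 → H →L[ℂ] H,
      MoriZwanzig.IsC0SemigroupGeneratedBy T (MoriZwanzig.mulBounded L.adjoint Q)) ∧
    ∀ S T : ℝ≥0 → H →L[ℂ] H,
      MoriZwanzig.IsC0SemigroupGeneratedBy S (MoriZwanzig.boundedMul Q L).closure →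
      MoriZwanzig.IsC0SemigroupGeneratedBy T (MoriZwanzig.mulBounded L.adjoint Q) →
      -- `G(t) = P + S(t) Q` is a strongly continuous semigroup with generator `closure(QL) Q`
      MoriZwanzig.IsC0SemigroupGeneratedBy (fun t => P + S t ∘L Q)
        (MoriZwanzig.mulBounded (MoriZwanzig.boundedMul Q L).closure Q) ∧
      -- `P + Q T(t)` is a strongly continuous semigroup and `G(t)` is its adjoint
      MoriZwanzig.IsC0Semigroup (fun t => P + Q ∘L T t) ∧
      ∀ t : ℝ≥0, P + S t ∘L Q = ContinuousLinearMap.adjoint (P + Q ∘L T t) := by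
  open MoriZwanzig in
  obtain ⟨hU, rfl⟩ := hUL
  have hPP : ∀ x, P (P x) = P x := hP ▸ moriProjection_comp_self hz
  have hPadj : ContinuousLinearMap.adjoint P = P := hP ▸ adjoint_moriProjection z
  have hQadj : ContinuousLinearMap.adjoint Q = Q := by
    rw [hQ, map_sub, hPadj]
    congr 1
    exact ContinuousLinearMap.adjoint_id
  have hQx : ∀ x, Q x = x - P x := fun x => by rw [hQ]; rfl
  obtain ⟨S, hS⟩ : ∃ S, IsC0SemigroupGeneratedBy S (boundedMul Q (generator U)) :=
    hQ ▸ hP ▸ exists_generatedBy_boundedMul hU hzL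
  have hclosed : (boundedMul Q (generator U)).IsClosed :=
    hS.generator_eq ▸ hS.isC0Semigroup.isClosed_generator
  have hT : IsC0SemigroupGeneratedBy (fun t => ContinuousLinearMap.adjoint (S t))
      (mulBounded (generator U).adjoint Q) := by
    refine ⟨hS.isC0Semigroup.adjoint, ?_⟩
    rw [hS.isC0Semigroup.generator_adjoint, hS.generator_eq,
      adjoint_boundedMul hU.dense_generator_domain, hQadj]
  have huniq : ∀ {A : H →ₗ.[ℂ] H} {V W : ℝ≥0 → H →L[ℂ] H}, IsC0SemigroupGeneratedBy V A →
      IsC0SemigroupGeneratedBy W A → V = W := fun hV hW =>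
    hV.isC0Semigroup.eq_of_generator_eq hW.isC0Semigroup (hV.generator_eq.trans hW.generator_eq.symm)
  rw [closure_eq_of_isClosed hclosed]
  refine ⟨hclosed.isClosable, ⟨S, hS, fun S' hS' => huniq hS' hS⟩,
    ⟨_, hT, fun T' hT' => huniq hT' hT⟩, ?_⟩
  intro S' T' hS' hT'
  obtain rfl := huniq hS' hS
  obtain rfl := huniq hT' hT
  have hS := hS'.isC0Semigroup
  have hPS : ∀ t x, P (S' t x) = P x := fun t x => hS.comp_eq_of_generator (fun a b hab => by
    rw [generator_eq_iff.1 hS'.generator_eq, mem_graph_boundedMul_iff] at hab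
    obtain ⟨l, -, rfl⟩ := hab
    rw [hQx, map_sub, hPP, sub_self]) t x
  have hG : IsC0Semigroup fun t => P + S' t ∘L Q := by
    refine ⟨?_, fun s t => ?_, fun x => ?_⟩
    · ext x
      simp [hS.zero_apply, hQx]
    · ext x
      simp only [add_apply, ContinuousLinearMap.comp_apply, hQx, map_add, map_sub, hPS, hPP,
        hS.add_apply]
      abel
    · exact continuous_const.add (hS.continuous_orbit (Q x))
  have hadj : ∀ t, ContinuousLinearMap.adjoint (P + S' t ∘L Q) =
      P + Q ∘L ContinuousLinearMap.adjoint (S' t) := fun t => by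
    rw [map_add, ContinuousLinearMap.adjoint_comp, hPadj, hQadj]
  refine ⟨⟨hG, generator_eq_iff.2 fun x y => ?_⟩, ?_, fun t => ?_⟩
  · rw [mem_graph_mulBounded_iff, ← generator_eq_iff.1 hS'.generator_eq]
    have e : ∀ h : ℝ≥0, (P + S' h ∘L Q) x - x = S' h (Q x) - Q x := fun h => by
      rw [add_apply, ContinuousLinearMap.comp_apply, hQx]
      abel
    simp only [HasOrbitDeriv, e]
  · simpa only [hadj] using hG.adjoint
  · rw [← hadj, ContinuousLinearMap.adjoint_adjoint]
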